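/- Let $X$ be a finite connected simple graph of diameter $d$, and for $0\le i\le d$ let $N_i(v)$ denote the set of vertices at distance $i$ from $v$ (with $N_{-1}(v)=N_{d+1}(v)=\emptyset$). The graph $X$ is called distance-regular if there are constants $a_i,b_i,c_i$ $(0\le i\le d)$ such that for every vertex $v$ and every $w\in N_i(v)$, the vertex $w$ has exactly $a_i$ neighbours in $N_i(v)$, exactly $b_i$ neighbours in $N_{i+1}(v)$ and exactly $c_i$ neighbours in $N_{i-1}(v)$. Such a graph is regular; let $k$ denote its degree. If $k=\xi_1\ge\xi_2\ge\dots\ge\xi_n$ are the eigenvalues of its adjacency matrix, with multiplicity, its zero-weight spectral radius is $\xi=\max\{|\xi_i| : 2\le i\le n\}$. Theorem. For every integer $d\ge 2$ there exist $\varepsilon=\varepsilon(d)>0$ and $\eta=\eta(d)>0$ such that for every distance-regular graph $X$ of diameter $d$ at least one of the following holds: 1. for some $0\le i\le d-1$ we have $b_i\ge\varepsilon k$ and $c_{i+1}\ge\varepsilon k$; 2. the zero-weight spectral radius of $X$ satisfies $\xi\le k(1-\eta)$. Moreover, one can take $$\eta=\tfrac14\, d^{-(1+\log_2 d)}\qquad\text{and}\qquad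 \varepsilon=200^{-(d+1)}\,d^{-(d+1)(\log_2 d+3)}.$$ -/

import Mathlib

/-- The finite graph `G` is distance-regular of diameter `d` with intersection numbers
`a i, b i, c i` for `0 ≤ i ≤ d`: it is connected of diameter `d`, and whenever `w` is at distance
`i` from `v`, the vertex `w` has exactly `a i` neighbours at distance `i` from `v`, exactly `b i`
neighbours at distance `i + 1` from `v` and exactly `c i` neighbours at distance `i - 1` from `v`
(so `c 0 = 0` and `b d = 0`). Values of `a`, `b`, `c` beyond `d` play no role. -/
structure IsDistanceRegular {V : Type*} [Fintype V] (G : SimpleGraph V) (d : ℕ)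
    (a b c : ℕ → ℕ) : Prop where
  connected : G.Connected
  diam_eq : G.diam = d
  card_a : ∀ i ≤ d, ∀ v w : V, G.dist v w = i →
    {x : V | G.Adj w x ∧ G.dist v x = i}.ncard = a i
  card_b : ∀ i ≤ d, ∀ v w : V, G.dist v w = i →
    {x : V | G.Adj w x ∧ G.dist v x = i + 1}.ncard = b i
  card_c : ∀ i ≤ d, ∀ v w : V, G.dist v w = i →
    {x : V | G.Adj w x ∧ G.dist v x + 1 = i}.ncard = c i

/-- A distance-regular graph is regular, and its degree is `b 0`. -/
theorem IsDistanceRegular.isRegularOfDegree {V : Type*} [Fintype V] {G : SimpleGraph V}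
    [DecidableRel G.Adj] {d : ℕ} {a b c : ℕ → ℕ} (h : IsDistanceRegular G d a b c) :
    G.IsRegularOfDegree (b 0) := by
  intro v
  have h0 := h.card_b 0 (Nat.zero_le d) v v SimpleGraph.dist_self
  have hs : {x : V | G.Adj v x ∧ G.dist v x = 0 + 1} = G.neighborFinset v := by
    ext x
    simp [SimpleGraph.dist_eq_one_iff_adj]
  rw [hs, Set.ncard_coe_finset] at h0
  exact h0

/-- The zero-weight spectral radius `max {|ξ_i| : 2 ≤ i ≤ n}` of a graph on `n` vertices, where
`ξ_1 ≥ ξ_2 ≥ … ≥ ξ_n` are the eigenvalues of the adjacency matrix with multiplicity.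
`eigenvalues₀` lists them in this order, indexed from `0`. -/
noncomputable def zeroWeightSpectralRadius {V : Type*} [Fintype V] [DecidableEq V]
    (G : SimpleGraph V) [DecidableRel G.Adj] : ℝ :=
  ⨆ i : {i : Fin (Fintype.card V) // 0 < (i : ℕ)},
    |(G.isHermitian_adjMatrix ℝ).eigenvalues₀ i.1|

/-!
Write `k = b 0` for the degree, `n` for the number of vertices and `N_i(v)` for the sphere of
radius `i` around `v`.

For adjacent `v` and `w` the proportion of `N_i(v)` lying outside `N_i(w)` is exactly
`(b i + c i) / k` (`IsDistanceRegular.degree_mul_card_distSphere_diff`). By the triangle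
inequality it is at most `d (b i + c i) / k` for arbitrary `v` and `w`. Hence, if `b i + c i` is
small compared to `k / d`, all spheres of radius `i` nearly coincide, and averaging over `w` shows
that they contain nearly all of the `n` vertices (`IsDistanceRegular.degree_mul_card_le`). Two
disjoint spheres cannot both do so; thus `b i + c i < k / (2 d)` for at most one index `i`
(`IsDistanceRegular.le_b_add_c_of_ne`).

Suppose that no `i < d` has both `b i` and `c (i + 1)` at least `ε k`, and let `m` be the least
index with `b m < ε k`. Then `c i < ε k` for `i ≤ m` and `b i < ε k` for `i ≥ m`. So `m` is the
exceptional index: `b i ≥ k / (4 d)` for `i < m` and `c i ≥ k / (4 d)` for `i > m`.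

Let `f` be an eigenvector for `θ` orthogonal to the constants, `v` a vertex with `f v ≠ 0`, and
`u i` the average of `f` over `N_i(v)`. Then `θ u_i = c_i u_{i-1} + a_i u_i + b_i u_{i+1}`, and
`u_m` is tiny compared to `M = max |u_i|`, since `f` has sum zero and `N_m(v)` contains nearly all
vertices. If `|θ|` exceeds `k (1 - 1 / (8 d))`, the recurrence carries this smallness from `m`
outwards in both directions, losing about a factor `2` per step (`abs_le_of_tridiagonal`). So all
`|u_i|` are less than `M`, which is absurd. This gives a gap of `k / (8 d)`
(`IsDistanceRegular.abs_eigenvalue_le`), more than what is needed.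
-/

open Finset

/-- The sphere of radius `i` around `v`, the set written `N_i(v)` in the literature. -/
noncomputable def SimpleGraph.distSphere {V : Type*} [Fintype V] (G : SimpleGraph V) (v : V)
    (i : ℕ) : Finset V :=
  {x | G.dist v x = i}

namespace IsDistanceRegular

variable {V : Type*} [Fintype V] {G : SimpleGraph V} {d : ℕ} {a b c : ℕ → ℕ}

/-! ### Distances and spheres -/

theorem dist_le (h : IsDistanceRegular G d a b c) (v w : V) : G.dist v w ≤ d := by
  have := h.connected.nonempty
  exact h.diam_eq ▸ SimpleGraph.dist_le_diam (SimpleGraph.connected_iff_ediam_ne_top.1 h.connected)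

theorem dist_adj (h : IsDistanceRegular G d a b c) {x y : V} (hxy : G.Adj x y) (v : V) :
    G.dist v x ≤ G.dist v y + 1 ∧ G.dist v y ≤ G.dist v x + 1 := by
  have h1 := SimpleGraph.dist_eq_one_iff_adj.2 hxy
  have h2 := SimpleGraph.dist_eq_one_iff_adj.2 hxy.symm
  have h3 : G.dist v x ≤ G.dist v y + G.dist y x := h.connected.dist_triangle
  have h4 : G.dist v y ≤ G.dist v x + G.dist x y := h.connected.dist_triangle
  omega

theorem adj_dist (h : IsDistanceRegular G d a b c) {x y : V} (hxy : G.Adj x y) (v : V) :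
    G.dist x v ≤ G.dist y v + 1 ∧ G.dist y v ≤ G.dist x v + 1 := by
  rw [SimpleGraph.dist_comm (u := x), SimpleGraph.dist_comm (u := y)]
  exact h.dist_adj hxy v

/-- A geodesic from `v` to `w` starts with a neighbour of `v` that is closer to `w`. -/
theorem exists_adj_dist (h : IsDistanceRegular G d a b c) {v w : V} {i : ℕ}
    (hi : G.dist v w = i + 1) : ∃ u, G.Adj v u ∧ G.dist u w = i := by
  obtain ⟨p, hp⟩ := h.connected.exists_walk_length_eq_dist v w
  cases p with
  | nil => simp at hi
  | @cons _ u _ hvu q =>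
    refine ⟨u, hvu, ?_⟩
    have h1 := SimpleGraph.dist_le q
    have h2 := h.adj_dist hvu w
    simp only [SimpleGraph.Walk.length_cons] at hp
    omega

theorem exists_dist_eq (h : IsDistanceRegular G d a b c) {i : ℕ} (hi : i ≤ d) :
    ∃ v w, G.dist v w = i := by
  induction hi using Nat.decreasingInduction with
  | self =>
    have := h.connected.nonempty
    obtain ⟨u, v, huv⟩ := G.exists_dist_eq_diam
    exact ⟨u, v, huv.trans h.diam_eq⟩
  | of_succ k _ ih =>
    obtain ⟨v, w, hvw⟩ := ih
    obtain ⟨u, -, hu⟩ := h.exists_adj_dist hvw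
    exact ⟨u, w, hu⟩

theorem distSphere_eq_empty (h : IsDistanceRegular G d a b c) (v : V) {i : ℕ} (hi : d < i) :
    G.distSphere v i = ∅ := by
  rw [SimpleGraph.distSphere, filter_eq_empty_iff]
  intro x _
  have := h.dist_le v x
  omega

theorem distSphere_zero (h : IsDistanceRegular G d a b c) (v : V) : G.distSphere v 0 = {v} := by
  ext x
  simp [SimpleGraph.distSphere, h.connected.dist_eq_zero_iff, eq_comm]

theorem sum_distSphere {M : Type*} [AddCommMonoid M] (h : IsDistanceRegular G d a b c) (v : V)
    (f : V → M) : ∑ i ∈ range (d + 1), ∑ x ∈ G.distSphere v i, f x = ∑ x, f x :=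
  sum_fiberwise_of_maps_to (fun x _ ↦ mem_range.2 (Nat.lt_succ_of_le (h.dist_le v x))) f

/-! ### Intersection numbers -/

variable [DecidableRel G.Adj]

theorem card_filter_a (h : IsDistanceRegular G d a b c) (v w : V) :
    #{x | G.Adj w x ∧ G.dist v x = G.dist v w} = a (G.dist v w) := by
  rw [← h.card_a _ (h.dist_le v w) v w rfl, ← Set.ncard_coe_finset]
  simp

theorem card_filter_b (h : IsDistanceRegular G d a b c) (v w : V) :
    #{x | G.Adj w x ∧ G.dist v x = G.dist v w + 1} = b (G.dist v w) := by
  rw [← h.card_b _ (h.dist_le v w) v w rfl, ← Set.ncard_coe_finset]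
  simp

theorem card_filter_c (h : IsDistanceRegular G d a b c) (v w : V) :
    #{x | G.Adj w x ∧ G.dist v x + 1 = G.dist v w} = c (G.dist v w) := by
  rw [← h.card_c _ (h.dist_le v w) v w rfl, ← Set.ncard_coe_finset]
  simp

theorem b_pos (h : IsDistanceRegular G d a b c) {i : ℕ} (hi : i < d) : 0 < b i := by
  obtain ⟨v, w, hvw⟩ := h.exists_dist_eq (Nat.succ_le_of_lt hi)
  obtain ⟨u, hu, hu'⟩ := h.exists_adj_dist hvw
  rw [← hu', SimpleGraph.dist_comm, ← h.card_filter_b w u, card_pos]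
  refine ⟨v, ?_⟩
  rw [mem_filter, SimpleGraph.dist_comm (u := w), SimpleGraph.dist_comm (u := w)]
  exact ⟨mem_univ _, hu.symm, by omega⟩

theorem c_pos (h : IsDistanceRegular G d a b c) {i : ℕ} (hi : i < d) : 0 < c (i + 1) := by
  obtain ⟨v, w, hvw⟩ := h.exists_dist_eq (Nat.succ_le_of_lt hi)
  obtain ⟨u, hu, hu'⟩ := h.exists_adj_dist hvw
  rw [← Nat.succ_eq_add_one, ← hvw, SimpleGraph.dist_comm, ← h.card_filter_c w v, card_pos]
  refine ⟨u, ?_⟩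
  rw [mem_filter, SimpleGraph.dist_comm (u := w), SimpleGraph.dist_comm (u := w)]
  exact ⟨mem_univ _, hu, by omega⟩

theorem c_zero (h : IsDistanceRegular G d a b c) : c 0 = 0 := by
  obtain ⟨v, w, hvw⟩ := h.exists_dist_eq (Nat.zero_le d)
  have e := h.card_filter_c v w
  rw [hvw] at e
  rw [← e, card_eq_zero, filter_eq_empty_iff]
  intro x _
  omega

theorem b_diam (h : IsDistanceRegular G d a b c) : b d = 0 := by
  obtain ⟨v, w, hvw⟩ := h.exists_dist_eq le_rfl
  rw [← hvw, ← h.card_filter_b v w, card_eq_zero, filter_eq_empty_iff]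
  intro x _
  have := h.dist_le v x
  omega

theorem b_succ_le (h : IsDistanceRegular G d a b c) {i : ℕ} (hi : i < d) : b (i + 1) ≤ b i := by
  obtain ⟨v, w, hvw⟩ := h.exists_dist_eq (Nat.succ_le_of_lt hi)
  obtain ⟨u, hu, hu'⟩ := h.exists_adj_dist hvw
  have e1 := h.card_filter_b v w
  have e2 := h.card_filter_b u w
  rw [hvw] at e1
  rw [hu'] at e2
  rw [← e2, ← Nat.succ_eq_add_one, ← e1]
  refine card_le_card fun x hx ↦ ?_
  simp only [mem_filter, mem_univ, true_and] at hx ⊢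
  have h1 := h.adj_dist hu x
  have h2 := h.dist_adj hx.1 u
  exact ⟨hx.1, by omega⟩

theorem b_antitone (h : IsDistanceRegular G d a b c) {i j : ℕ} (hij : i ≤ j) (hj : j ≤ d) :
    b j ≤ b i := by
  induction hij with
  | refl => exact le_rfl
  | @step m _ ih => exact (h.b_succ_le hj).trans (ih (by omega))

theorem a_add_b_add_c (h : IsDistanceRegular G d a b c) {i : ℕ} (hi : i ≤ d) :
    a i + b i + c i = b 0 := by
  classical
  obtain ⟨v, w, hvw⟩ := h.exists_dist_eq hi
  have e := h.isRegularOfDegree w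
  rw [← hvw, ← e, ← h.card_filter_a v w, ← h.card_filter_b v w, ← h.card_filter_c v w,
    ← card_union_of_disjoint, ← card_union_of_disjoint, ← G.card_neighborFinset_eq_degree]
  · congr 1
    ext x
    simp only [mem_union, mem_filter, mem_univ, true_and, SimpleGraph.mem_neighborFinset]
    refine ⟨by tauto, fun hx ↦ ?_⟩
    have := h.dist_adj hx v
    have : G.dist v x = G.dist v w ∨ G.dist v x = G.dist v w + 1 ∨
      G.dist v x + 1 = G.dist v w := by omega
    tauto
  · rw [disjoint_left]
    simp only [mem_union, mem_filter, mem_univ, true_and]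
    omega
  · rw [disjoint_left]
    simp only [mem_filter, mem_univ, true_and]
    omega

/-! ### Sizes of spheres -/

/-- Double counting of the edges between consecutive spheres. -/
theorem card_distSphere_mul_b (h : IsDistanceRegular G d a b c) (v : V) (i : ℕ) :
    #(G.distSphere v i) * b i = #(G.distSphere v (i + 1)) * c (i + 1) := by
  refine card_mul_eq_card_mul G.Adj (fun x hx ↦ ?_) fun y hy ↦ ?_
  · simp only [SimpleGraph.distSphere, mem_filter, mem_univ, true_and] at hx
    rw [← hx, ← h.card_filter_b v x]
    congr 1
    ext y
    simp [bipartiteAbove, SimpleGraph.distSphere, and_comm]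
  · simp only [SimpleGraph.distSphere, mem_filter, mem_univ, true_and] at hy
    rw [← hy, ← h.card_filter_c v y, hy]
    congr 1
    ext x
    simp [bipartiteBelow, SimpleGraph.distSphere, and_comm, SimpleGraph.adj_comm]

theorem card_distSphere_eq (h : IsDistanceRegular G d a b c) (v w : V) (i : ℕ) :
    #(G.distSphere v i) = #(G.distSphere w i) := by
  induction i with
  | zero => simp [h.distSphere_zero]
  | succ i ih =>
    rcases lt_or_ge i d with hi | hi
    · refine Nat.eq_of_mul_eq_mul_right (h.c_pos hi) ?_
      rw [← h.card_distSphere_mul_b, ← h.card_distSphere_mul_b, ih]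
    · simp [h.distSphere_eq_empty _ (Nat.lt_succ_of_le hi)]

theorem card_distSphere_pos (h : IsDistanceRegular G d a b c) (v : V) {i : ℕ} (hi : i ≤ d) :
    0 < #(G.distSphere v i) := by
  induction i with
  | zero => simp [h.distSphere_zero]
  | succ i ih =>
    have h1 := h.card_distSphere_mul_b v i
    have h2 : 0 < #(G.distSphere v i) * b i := Nat.mul_pos (ih (by omega)) (h.b_pos (by omega))
    exact Nat.pos_of_mul_pos_right (h1 ▸ h2)

/-! ### Moving the centre of a sphere -/

/-- For adjacent `v` and `w`, the number of vertices at distance `i + 1` from `v` and `i` from `w`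
depends on `i` only: double counting of the edges inside these sets gives a recursion. -/
theorem card_dist_succ_dist_eq (h : IsDistanceRegular G d a b c) {v w v' w' : V}
    (hvw : G.Adj v w) (hvw' : G.Adj v' w') (i : ℕ) :
    #{x | G.dist v x = i + 1 ∧ G.dist w x = i} = #{x | G.dist v' x = i + 1 ∧ G.dist w' x = i} := by
  have step : ∀ {v w : V}, G.Adj v w → ∀ i,
      #{x | G.dist v x = i + 1 ∧ G.dist w x = i} * b (i + 1) =
        #{x | G.dist v x = i + 1 + 1 ∧ G.dist w x = i + 1} * c (i + 1) := by
    intro v w hvw i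
    refine card_mul_eq_card_mul G.Adj (fun x hx ↦ ?_) fun y hy ↦ ?_
    · simp only [mem_filter, mem_univ, true_and] at hx
      rw [← hx.1, ← h.card_filter_b v x]
      congr 1
      ext y
      simp only [bipartiteAbove, mem_filter, mem_univ, true_and]
      refine ⟨fun hy ↦ ⟨hy.2, by omega⟩, fun hy ↦ ?_⟩
      have h1 := h.adj_dist hvw y
      have h2 := h.dist_adj hy.1 w
      exact ⟨by omega, hy.1⟩
    · simp only [mem_filter, mem_univ, true_and] at hy
      rw [← hy.2, ← h.card_filter_c w y]
      congr 1
      ext x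
      simp only [bipartiteBelow, mem_filter, mem_univ, true_and]
      refine ⟨fun hx ↦ ⟨hx.2.symm, by omega⟩, fun hx ↦ ?_⟩
      have h1 := h.adj_dist hvw x
      have h2 := h.dist_adj hx.1 v
      exact ⟨by omega, hx.1.symm⟩
  induction i with
  | zero =>
    have base : ∀ {v w : V}, G.Adj v w → #{x | G.dist v x = 0 + 1 ∧ G.dist w x = 0} = 1 := by
      intro v w hvw
      rw [card_eq_one]
      refine ⟨w, ?_⟩
      ext x
      simp only [mem_filter, mem_univ, true_and, mem_singleton, h.connected.dist_eq_zero_iff]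
      refine ⟨fun hx ↦ hx.2.symm, ?_⟩
      rintro rfl
      exact ⟨SimpleGraph.dist_eq_one_iff_adj.2 hvw, rfl⟩
    rw [base hvw, base hvw']
  | succ i ih =>
    rcases lt_or_ge i d with hi | hi
    · refine Nat.eq_of_mul_eq_mul_right (h.c_pos hi) ?_
      rw [← step hvw, ← step hvw', ih]
    · have empty : ∀ v w : V, #{x | G.dist v x = i + 1 + 1 ∧ G.dist w x = i + 1} = 0 := by
        intro v w
        rw [card_eq_zero, filter_eq_empty_iff]
        intro x _
        have := h.dist_le v x
        omega
      rw [empty, empty]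

/-- For adjacent `v` and `w`, the size of `N_i(v) \ N_i(w)` does not depend on `v` and `w`. -/
theorem card_distSphere_diff_eq (h : IsDistanceRegular G d a b c) {v w v' w' : V}
    (hvw : G.Adj v w) (hvw' : G.Adj v' w') (i : ℕ) :
    #{x | G.dist v x = i ∧ G.dist w x ≠ i} = #{x | G.dist v' x = i ∧ G.dist w' x ≠ i} := by
  classical
  have split : ∀ {v w : V}, G.Adj v w → #{x | G.dist v x = i ∧ G.dist w x ≠ i} =
      #{x | G.dist w x = i + 1 ∧ G.dist v x = i} +
        #{x | G.dist v x = i ∧ G.dist w x + 1 = i} := by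
    intro v w hvw
    rw [← card_union_of_disjoint]
    · congr 1
      ext x
      have := h.adj_dist hvw x
      simp only [mem_union, mem_filter, mem_univ, true_and]
      omega
    · rw [disjoint_left]
      simp only [mem_filter, mem_univ, true_and]
      omega
  rw [split hvw, split hvw', h.card_dist_succ_dist_eq hvw.symm hvw'.symm]
  cases i with
  | zero => simp
  | succ i => simpa using h.card_dist_succ_dist_eq hvw hvw' i

/-- For adjacent `v` and `w`, a proportion of exactly `(b i + c i) / k` of the sphere `N_i(v)`
lies outside `N_i(w)`: this is the average over the neighbours `w` of `v`, and all of them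
contribute equally. -/
theorem degree_mul_card_distSphere_diff (h : IsDistanceRegular G d a b c) {v w : V}
    (hvw : G.Adj v w) {i : ℕ} (hi : i ≤ d) :
    b 0 * #{x | G.dist v x = i ∧ G.dist w x ≠ i} = #(G.distSphere v i) * (b i + c i) := by
  have e := h.isRegularOfDegree v
  rw [← G.card_neighborFinset_eq_degree] at e
  rw [← e]
  symm
  refine card_mul_eq_card_mul (fun x u ↦ G.dist u x ≠ i) (fun x hx ↦ ?_) fun u hu ↦ ?_
  · simp only [SimpleGraph.distSphere, mem_filter, mem_univ, true_and] at hx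
    have h1 := h.a_add_b_add_c hi
    have h2 := h.card_filter_a x v
    rw [SimpleGraph.dist_comm, hx] at h2
    have h3 := card_filter_add_card_filter_not (s := G.neighborFinset v) (fun u ↦ G.dist u x = i)
    have h4 : #{u ∈ G.neighborFinset v | G.dist u x = i} = a i := by
      rw [← h2]
      congr 1
      ext u
      simp [SimpleGraph.dist_comm]
    rw [bipartiteAbove]
    simp only [ne_eq]
    omega
  · rw [SimpleGraph.mem_neighborFinset] at hu
    rw [h.card_distSphere_diff_eq hvw hu]
    congr 1
    ext x
    simp [bipartiteBelow, SimpleGraph.distSphere]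

/-- The triangle inequality for the sizes of the differences `N_i(v) \ N_i(w)`. -/
theorem degree_mul_card_distSphere_diff_le (h : IsDistanceRegular G d a b c) (v w : V) {i : ℕ}
    (hi : i ≤ d) :
    b 0 * #{x | G.dist v x = i ∧ G.dist w x ≠ i} ≤ d * (#(G.distSphere v i) * (b i + c i)) := by
  classical
  have walk : ∀ {v w : V} (p : G.Walk v w), b 0 * #{x | G.dist v x = i ∧ G.dist w x ≠ i} ≤
      p.length * (#(G.distSphere v i) * (b i + c i)) := by
    intro v w p
    induction p with
    | nil => simp
    | @cons v u w hvu q ih =>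
      rw [h.card_distSphere_eq u v] at ih
      have step := h.degree_mul_card_distSphere_diff hvu hi
      have union : #{x | G.dist v x = i ∧ G.dist w x ≠ i} ≤
          #{x | G.dist v x = i ∧ G.dist u x ≠ i} + #{x | G.dist u x = i ∧ G.dist w x ≠ i} := by
        refine le_trans (card_le_card fun x hx ↦ ?_) (card_union_le _ _)
        simp only [mem_union, mem_filter, mem_univ, true_and] at hx ⊢
        omega
      have := Nat.mul_le_mul_left (b 0) union
      rw [SimpleGraph.Walk.length_cons, add_mul, one_mul]
      linarith
  obtain ⟨p, hp⟩ := h.connected.exists_walk_length_eq_dist v w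
  exact (walk p).trans (Nat.mul_le_mul_right _ (hp ▸ h.dist_le v w))

/-- If `b i + c i` is small compared to `k / d`, then the spheres of radius `i` contain almost all
vertices: any two of them almost coincide, so that almost all vertices of one such sphere have
almost all vertices at distance `i`. -/
theorem degree_mul_card_le (h : IsDistanceRegular G d a b c) (v : V) {i : ℕ} (hi : i ≤ d) :
    b 0 * Fintype.card V ≤
      b 0 * #(G.distSphere v i) + Fintype.card V * (d * (b i + c i)) := by
  set K := #(G.distSphere v i) with hK
  have hKpos : 0 < K := h.card_distSphere_pos v hi
  have h1 : ∑ w : V, #{x ∈ G.distSphere v i | G.dist w x = i} = K * K := by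
    have := sum_card_bipartiteAbove_eq_sum_card_bipartiteBelow (fun w x ↦ G.dist w x = i)
      (s := (univ : Finset V)) (t := G.distSphere v i)
    simp only [bipartiteAbove] at this
    rw [this]
    refine (sum_congr rfl fun x _ ↦ ?_).trans (by rw [sum_const, smul_eq_mul])
    rw [hK, h.card_distSphere_eq v x]
    congr 1
    ext y
    simp [bipartiteBelow, SimpleGraph.distSphere, SimpleGraph.dist_comm]
  have h2 : ∀ w : V, b 0 * K ≤
      b 0 * #{x ∈ G.distSphere v i | G.dist w x = i} + d * (K * (b i + c i)) := by
    intro w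
    have h3 := card_filter_add_card_filter_not (s := G.distSphere v i) (fun x ↦ G.dist w x = i)
    have h4 := h.degree_mul_card_distSphere_diff_le v w hi
    have h5 : #{x ∈ G.distSphere v i | ¬ G.dist w x = i} =
        #{x | G.dist v x = i ∧ G.dist w x ≠ i} := by
      congr 1
      ext x
      simp [SimpleGraph.distSphere]
    rw [h5] at h3
    have h7 := congrArg (b 0 * ·) h3
    simp only [Nat.mul_add] at h7
    rw [hK]
    linarith
  have h6 := sum_le_sum fun w (_ : w ∈ (univ : Finset V)) ↦ h2 w
  rw [sum_const, sum_add_distrib, sum_const, ← mul_sum, h1, card_univ, smul_eq_mul,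
    smul_eq_mul] at h6
  refine Nat.le_of_mul_le_mul_right ?_ hKpos
  linarith

end IsDistanceRegular

/-! ### Tridiagonal recurrences -/

/-- Let `u` satisfy the eigenvalue equation of a tridiagonal stochastic matrix (scaled by `k`) in
which `b` dominates `c` left of the index `m` and `c` dominates `b` right of it. If `|θ|` is close
to `k` and `u m` is small, then `u` is small everywhere: by the equation at the index `i`, the
value `u i` is controlled by its neighbour on the side of `m`. -/
theorem abs_le_of_tridiagonal {d m : ℕ} {a b c u : ℕ → ℝ} {k γ M θ : ℝ}
    (hu : ∀ i ≤ d, θ * u i = c i * u (i - 1) + a i * u i + b i * u (i + 1))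
    (hk : ∀ i ≤ d, a i + b i + c i = k)
    (ha : ∀ i, 0 ≤ a i) (hb : ∀ i, 0 ≤ b i) (hc : ∀ i, 0 ≤ c i)
    (hγ : 0 ≤ γ) (hM : ∀ i, |u i| ≤ M) (hmd : m ≤ d) (hm : |u m| ≤ γ * M)
    (hlt : ∀ i < m, 0 < b i ∧ c i ≤ γ * b i ∧ k - |θ| ≤ b i / 2)
    (hgt : ∀ i ≤ d, m < i → 0 < c i ∧ b i ≤ γ * c i ∧ k - |θ| ≤ c i / 2) :
    ∀ i ≤ d, |u i| ≤ 3 * 2 ^ d * γ * M := by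
  have hM0 : 0 ≤ M := (abs_nonneg _).trans (hM 0)
  have htri : ∀ i ≤ d, (|θ| - a i) * |u i| ≤ c i * |u (i - 1)| + b i * |u (i + 1)| := by
    intro i hi
    have h1 : |θ| * |u i| ≤ c i * |u (i - 1)| + a i * |u i| + b i * |u (i + 1)| := by
      rw [← abs_mul, hu i hi]
      refine (abs_add_three _ _ _).trans_eq ?_
      rw [abs_mul, abs_mul, abs_mul, abs_of_nonneg (ha i), abs_of_nonneg (hb i),
        abs_of_nonneg (hc i)]
    linarith
  -- The two sides of `m` are treated alike: `p` is the dominating coefficient, `q` the other one.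
  have hstep : ∀ {p q t x y z : ℝ}, 0 < p → 0 ≤ q → q ≤ γ * p → p + q - p / 2 ≤ t → 0 ≤ x →
      t * x ≤ q * y + p * z → y ≤ M → x ≤ 2 * γ * M + 2 * z := by
    intro p q t x y z hp hq hqp ht hx hxyz hy
    have h1 : p / 2 * x ≤ t * x := mul_le_mul_of_nonneg_right (by linarith) hx
    have h2 : q * y ≤ γ * p * M :=
      (mul_le_mul_of_nonneg_left hy hq).trans (mul_le_mul_of_nonneg_right hqp hM0)
    refine le_of_mul_le_mul_left ?_ (half_pos hp)
    linarith
  have hleft : ∀ r ≤ m, |u (m - r)| ≤ (3 * 2 ^ r - 2) * (γ * M) := by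
    intro r
    induction r with
    | zero => intro _; norm_num; exact hm
    | succ r ih =>
      intro hr
      have h1 := ih (by omega)
      obtain ⟨hb0, hcb, hθ⟩ := hlt (m - (r + 1)) (by omega)
      have h2 := htri (m - (r + 1)) (by omega)
      have h3 := hk (m - (r + 1)) (by omega)
      have h4 := hstep hb0 (hc _) hcb (by linarith) (abs_nonneg _) h2 (hM _)
      rw [show m - (r + 1) + 1 = m - r by omega] at h4
      rw [pow_succ]
      linarith
  have hright : ∀ r, m + r ≤ d → |u (m + r)| ≤ (3 * 2 ^ r - 2) * (γ * M) := by
    intro r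
    induction r with
    | zero => intro _; norm_num; exact hm
    | succ r ih =>
      intro hr
      have h1 := ih (by omega)
      obtain ⟨hc0, hbc, hθ⟩ := hgt (m + (r + 1)) hr (by omega)
      have h2 := htri (m + (r + 1)) hr
      have h3 := hk (m + (r + 1)) hr
      rw [add_comm (c _ * _)] at h2
      have h4 := hstep hc0 (hb _) hbc (by linarith) (abs_nonneg _) h2 (hM _)
      rw [show m + (r + 1) - 1 = m + r by omega] at h4
      rw [pow_succ]
      linarith
  intro i hi
  have hfin : ∀ r ≤ d, ((3 : ℝ) * 2 ^ r - 2) * (γ * M) ≤ 3 * 2 ^ d * γ * M := by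
    intro r hr
    have h1 : (2 : ℝ) ^ r ≤ 2 ^ d := pow_le_pow_right₀ one_le_two hr
    rw [mul_assoc _ γ M]
    exact mul_le_mul_of_nonneg_right (by linarith) (mul_nonneg hγ hM0)
  rcases le_total i m with him | him
  · have h1 := hleft (m - i) (by omega)
    rw [show m - (m - i) = i by omega] at h1
    exact h1.trans (hfin _ (by omega))
  · have h1 := hright (i - m) (by omega)
    rw [show m + (i - m) = i by omega] at h1
    exact h1.trans (hfin _ (by omega))

/-! ### Eigenvectors averaged over spheres -/

/-- The average of `f` over the sphere of radius `i` around `v`, with value `0` if the sphere is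
empty. -/
noncomputable def SimpleGraph.sphereAverage {V : Type*} [Fintype V] (G : SimpleGraph V) (f : V → ℝ)
    (v : V) (i : ℕ) : ℝ :=
  (∑ x ∈ G.distSphere v i, f x) / #(G.distSphere v i)

theorem SimpleGraph.card_mul_sphereAverage {V : Type*} [Fintype V] (G : SimpleGraph V) (f : V → ℝ)
    (v : V) (i : ℕ) :
    #(G.distSphere v i) * G.sphereAverage f v i = ∑ x ∈ G.distSphere v i, f x := by
  rcases (G.distSphere v i).eq_empty_or_nonempty with h | h
  · simp [h]
  · rw [SimpleGraph.sphereAverage, mul_div_cancel₀]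
    exact_mod_cast h.card_pos.ne'

namespace IsDistanceRegular

variable {V : Type*} [Fintype V] {G : SimpleGraph V} [DecidableRel G.Adj] {d : ℕ} {a b c : ℕ → ℕ}

/-- The number of neighbours of `y` at distance `i` from `v`. -/
theorem card_filter_adj (h : IsDistanceRegular G d a b c) (v y : V) (i : ℕ) :
    #{x ∈ G.distSphere v i | G.Adj x y} =
      (if i = G.dist v y then a (G.dist v y) else 0) +
      ((if i = G.dist v y + 1 then b (G.dist v y) else 0) +
        if i + 1 = G.dist v y then c (G.dist v y) else 0) := by
  have heq : {x ∈ G.distSphere v i | G.Adj x y} =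
      ({x | G.Adj y x ∧ G.dist v x = i} : Finset V) := by
    ext x
    simp [SimpleGraph.distSphere, and_comm, SimpleGraph.adj_comm]
  rw [heq]
  split_ifs with h1 h2 h3 h3 h2 h3 h3
  all_goals try omega
  · rw [h1, h.card_filter_a, add_zero, add_zero]
  · rw [h2, h.card_filter_b, add_zero, zero_add]
  · rw [← h.card_filter_c, zero_add, zero_add]
    congr 1
    ext x
    simp only [mem_filter, mem_univ, true_and]
    exact and_congr_right fun _ ↦ by omega
  · rw [add_zero, card_eq_zero, filter_eq_empty_iff]
    intro x _ hx
    have := h.dist_adj hx.1 v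
    have := hx.2
    omega

/-- The sphere averages of an eigenvector satisfy the recurrence of the intersection matrix. -/
theorem sphereAverage_recurrence (h : IsDistanceRegular G d a b c) {f : V → ℝ} {θ : ℝ}
    (hf : ∀ x, ∑ y ∈ G.neighborFinset x, f y = θ * f x) (v : V) {i : ℕ} (hi : i ≤ d) :
    θ * G.sphereAverage f v i = c i * G.sphereAverage f v (i - 1) + a i * G.sphereAverage f v i +
      b i * G.sphereAverage f v (i + 1) := by
  have hK : (0 : ℝ) < #(G.distSphere v i) := by exact_mod_cast h.card_distSphere_pos v hi
  have hbc : ∀ j, (#(G.distSphere v j) : ℝ) * b j = #(G.distSphere v (j + 1)) * c (j + 1) :=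
    fun j ↦ by exact_mod_cast h.card_distSphere_mul_b v j
  have h1 : θ * ∑ x ∈ G.distSphere v i, f x =
      ∑ y, (#{x ∈ G.distSphere v i | G.Adj x y} : ℝ) * f y := by
    rw [mul_sum]
    simp_rw [← hf, ← nsmul_eq_mul, ← sum_const, SimpleGraph.neighborFinset_eq_filter, sum_filter]
    exact sum_comm
  have h2 : ∑ y, (#{x ∈ G.distSphere v i | G.Adj x y} : ℝ) * f y =
      ∑ j ∈ range (d + 1), ((if i = j then (a j : ℝ) else 0) +
        ((if i = j + 1 then (b j : ℝ) else 0) + if i + 1 = j then (c j : ℝ) else 0)) *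
          ∑ y ∈ G.distSphere v j, f y := by
    rw [← h.sum_distSphere v]
    refine sum_congr rfl fun j _ ↦ ?_
    rw [mul_sum]
    refine sum_congr rfl fun y hy ↦ ?_
    simp only [SimpleGraph.distSphere, mem_filter, mem_univ, true_and] at hy
    rw [h.card_filter_adj v y i, hy]
    push_cast
    rfl
  simp only [← G.card_mul_sphereAverage, add_mul, sum_add_distrib] at h1 h2
  have ha : ∑ j ∈ range (d + 1), (if i = j then (a j : ℝ) else 0) *
      (#(G.distSphere v j) * G.sphereAverage f v j) =
        #(G.distSphere v i) * (a i * G.sphereAverage f v i) := by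
    rw [sum_eq_single_of_mem i (mem_range.2 (by omega))]
    · rw [if_pos rfl]; ring
    · intro j _ hj
      rw [if_neg hj.symm, zero_mul]
  have hb : ∑ j ∈ range (d + 1), (if i = j + 1 then (b j : ℝ) else 0) *
      (#(G.distSphere v j) * G.sphereAverage f v j) =
        #(G.distSphere v i) * (c i * G.sphereAverage f v (i - 1)) := by
    cases i with
    | zero => simp [h.c_zero]
    | succ i =>
      rw [sum_eq_single_of_mem i (mem_range.2 (by omega))]
      · rw [if_pos rfl, Nat.add_sub_cancel]
        linear_combination G.sphereAverage f v i * hbc i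
      · intro j _ hj
        rw [if_neg (by omega), zero_mul]
  have hc : ∑ j ∈ range (d + 1), (if i + 1 = j then (c j : ℝ) else 0) *
      (#(G.distSphere v j) * G.sphereAverage f v j) =
        #(G.distSphere v i) * (b i * G.sphereAverage f v (i + 1)) := by
    rcases hi.eq_or_lt with rfl | hi'
    · rw [h.b_diam, Nat.cast_zero, zero_mul, mul_zero]
      refine sum_eq_zero fun j hj ↦ ?_
      rw [mem_range] at hj
      rw [if_neg (by omega), zero_mul]
    · rw [sum_eq_single_of_mem (i + 1) (mem_range.2 (by omega))]
      · rw [if_pos rfl]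
        linear_combination -G.sphereAverage f v (i + 1) * hbc i
      · intro j _ hj
        rw [if_neg hj.symm, zero_mul]
  refine mul_left_cancel₀ hK.ne' ?_
  rw [ha, hb, hc] at h2
  linear_combination h1 + h2

/-! ### The spectral gap -/

/-- At most one index can have `b i + c i` small: otherwise each of two disjoint spheres would
contain half of the vertices, and one of them more than that. -/
theorem le_b_add_c_of_ne (h : IsDistanceRegular G d a b c) (hd : 0 < d) {i m : ℕ} (hi : i ≤ d)
    (hm : m ≤ d) (him : i ≠ m) (hbc : (b m + c m : ℝ) ≤ b 0 / (2 * d)) :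
    (b 0 : ℝ) / (2 * d) ≤ b i + c i := by
  classical
  by_contra! hlt
  obtain ⟨v⟩ := h.connected.nonempty
  have hk : (0 : ℝ) < b 0 := by exact_mod_cast h.b_pos hd
  have hd' : (0 : ℝ) < d := by exact_mod_cast hd
  have hn : (0 : ℝ) < Fintype.card V := by exact_mod_cast Fintype.card_pos_iff.2 ⟨v⟩
  have hKi : (b 0 : ℝ) * Fintype.card V ≤
      b 0 * #(G.distSphere v i) + Fintype.card V * (d * (b i + c i)) := by
    exact_mod_cast h.degree_mul_card_le v hi
  have hKm : (b 0 : ℝ) * Fintype.card V ≤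
      b 0 * #(G.distSphere v m) + Fintype.card V * (d * (b m + c m)) := by
    exact_mod_cast h.degree_mul_card_le v hm
  have hsum : (#(G.distSphere v i) : ℝ) + #(G.distSphere v m) ≤ Fintype.card V := by
    have hdisj : Disjoint (G.distSphere v i) (G.distSphere v m) := by
      rw [disjoint_left]
      simp only [SimpleGraph.distSphere, mem_filter, mem_univ, true_and]
      omega
    rw [← Nat.cast_add, ← card_union_of_disjoint hdisj]
    exact_mod_cast card_le_univ _
  have h1 : (d : ℝ) * (b i + c i) < b 0 / 2 := by
    calc (d : ℝ) * (b i + c i) < d * (b 0 / (2 * d)) := mul_lt_mul_of_pos_left hlt hd'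
      _ = b 0 / 2 := by field_simp
  have h2 : (d : ℝ) * (b m + c m) ≤ b 0 / 2 := by
    calc (d : ℝ) * (b m + c m) ≤ d * (b 0 / (2 * d)) := mul_le_mul_of_nonneg_left hbc hd'.le
      _ = b 0 / 2 := by field_simp
  have h3 := mul_lt_mul_of_pos_left h1 hn
  have h4 := mul_le_mul_of_nonneg_left h2 hn.le
  have h5 := mul_le_mul_of_nonneg_left hsum hk.le
  linarith

/-- If the spheres of radius `m` contain almost all vertices, then the averages over them of a
function with sum zero are small. -/
theorem abs_sphereAverage_le (h : IsDistanceRegular G d a b c) (hd : 0 < d) {m : ℕ} (hm : m ≤ d)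
    {ε M : ℝ} (hε : 4 * d * ε ≤ 1) (hbc : (b m + c m : ℝ) ≤ 2 * ε * b 0)
    {f : V → ℝ} (hf : ∑ x, f x = 0) (v : V) (hM : ∀ i, |G.sphereAverage f v i| ≤ M) :
    |G.sphereAverage f v m| ≤ 4 * d * ε * M := by
  have hk : (0 : ℝ) < b 0 := by exact_mod_cast h.b_pos hd
  have hM0 : 0 ≤ M := (abs_nonneg _).trans (hM 0)
  have hn : (0 : ℝ) < Fintype.card V := by exact_mod_cast Fintype.card_pos_iff.2 ⟨v⟩
  have hK : (b 0 : ℝ) * Fintype.card V ≤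
      b 0 * #(G.distSphere v m) + Fintype.card V * (d * (b m + c m)) := by
    exact_mod_cast h.degree_mul_card_le v hm
  have hK' : (1 - 2 * d * ε) * Fintype.card V ≤ (#(G.distSphere v m) : ℝ) := by
    refine le_of_mul_le_mul_left ?_ hk
    have h1 : (Fintype.card V : ℝ) * (d * (b m + c m)) ≤
        Fintype.card V * (d * (2 * ε * b 0)) := by gcongr
    linarith
  have hsum : ∑ i ∈ range (d + 1), #(G.distSphere v i) * G.sphereAverage f v i = 0 := by
    simp_rw [G.card_mul_sphereAverage]
    rw [h.sum_distSphere, hf]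
  have hcard : ∑ i ∈ range (d + 1), (#(G.distSphere v i) : ℝ) = Fintype.card V := by
    have := h.sum_distSphere v (fun _ ↦ (1 : ℝ))
    simpa using this
  have hmem : m ∈ range (d + 1) := mem_range.2 (by omega)
  rw [← add_sum_erase _ _ hmem] at hsum hcard
  have h1 : |∑ i ∈ (range (d + 1)).erase m, #(G.distSphere v i) * G.sphereAverage f v i| ≤
      (∑ i ∈ (range (d + 1)).erase m, (#(G.distSphere v i) : ℝ)) * M := by
    rw [sum_mul]
    refine (abs_sum_le_sum_abs _ _).trans (sum_le_sum fun i _ ↦ ?_)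
    rw [abs_mul, Nat.abs_cast]
    exact mul_le_mul_of_nonneg_left (hM i) (Nat.cast_nonneg _)
  have h2 : #(G.distSphere v m) * |G.sphereAverage f v m| ≤
      (Fintype.card V - #(G.distSphere v m)) * M := by
    rw [← hcard, add_sub_cancel_left]
    refine le_trans (le_of_eq ?_) h1
    rw [← Nat.abs_cast (#(G.distSphere v m)), ← abs_mul, ← abs_neg, eq_neg_of_add_eq_zero_left hsum,
      neg_neg]
  have h3 : (Fintype.card V - #(G.distSphere v m)) * M ≤ 2 * d * ε * Fintype.card V * M :=
    mul_le_mul_of_nonneg_right (by linarith) hM0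
  have h4 : (Fintype.card V : ℝ) / 2 * |G.sphereAverage f v m| ≤
      #(G.distSphere v m) * |G.sphereAverage f v m| := by
    refine mul_le_mul_of_nonneg_right (le_trans ?_ hK') (abs_nonneg _)
    have := mul_le_mul_of_nonneg_right hε hn.le
    linarith
  refine le_of_mul_le_mul_left ?_ (half_pos hn)
  linarith

/-- The spectral gap: an eigenvector orthogonal to the constants has its eigenvalue bounded away
from `±k`, unless `b i` and `c (i + 1)` are both large for some `i`. -/
theorem abs_eigenvalue_le (h : IsDistanceRegular G d a b c) (hd : 0 < d) {ε : ℝ} (hε0 : 0 < ε)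
    (hε : 12 * d * 2 ^ d * ε < 1) (hbc : ∀ i < d, ε * b 0 ≤ b i → (c (i + 1) : ℝ) < ε * b 0)
    {f : V → ℝ} {θ : ℝ} (hf : ∀ x, ∑ y ∈ G.neighborFinset x, f y = θ * f x)
    (hsum : ∑ x, f x = 0) (hf0 : f ≠ 0) : |θ| ≤ b 0 * (1 - 1 / (8 * d)) := by
  classical
  by_contra! hθ
  obtain ⟨v, hv⟩ := Function.ne_iff.1 hf0
  have hk : (0 : ℝ) < b 0 := by exact_mod_cast h.b_pos hd
  have hd' : (0 : ℝ) < d := by exact_mod_cast hd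
  have hdε : 8 * d * ε ≤ 1 := by
    have h1 : (1 : ℝ) ≤ 2 ^ d := one_le_pow₀ one_le_two
    have h2 := mul_le_mul_of_nonneg_left h1 (mul_pos hd' hε0).le
    have h3 := mul_pos hd' hε0
    linarith
  have hεk : 2 * ε * b 0 ≤ b 0 / (4 * d) := by
    rw [le_div_iff₀ (by positivity)]
    have := mul_le_mul_of_nonneg_right hdε hk.le
    linarith
  -- `m` is the first index at which `b` is small; the spheres of radius `m` turn out to be huge.
  have hex : ∃ i, (b i : ℝ) < ε * b 0 := ⟨d, by rw [h.b_diam, Nat.cast_zero]; positivity⟩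
  obtain ⟨m, hm, hmin⟩ : ∃ m, (b m : ℝ) < ε * b 0 ∧ ∀ i < m, ε * b 0 ≤ (b i : ℝ) :=
    ⟨Nat.find hex, Nat.find_spec hex, fun i hi ↦ not_lt.1 (Nat.find_min hex hi)⟩
  have hmd : m ≤ d := by
    by_contra! hdm
    have := hmin d hdm
    rw [h.b_diam, Nat.cast_zero] at this
    exact absurd this (not_le.2 (by positivity))
  have hc : ∀ i ≤ m, (c i : ℝ) < ε * b 0 := by
    intro i hi
    cases i with
    | zero => rw [h.c_zero, Nat.cast_zero]; positivity
    | succ i => exact hbc i (by omega) (hmin i (by omega))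
  have hb : ∀ i ≤ d, m < i → (b i : ℝ) < ε * b 0 := fun i hi hmi ↦
    lt_of_le_of_lt (by exact_mod_cast h.b_antitone hmi.le hi) hm
  have hbm : (b m + c m : ℝ) ≤ 2 * ε * b 0 := by
    have := hc m le_rfl
    linarith
  have hdiv : (b 0 : ℝ) / (2 * d) = 2 * (b 0 / (4 * d)) := by field_simp; norm_num
  have hdiv' : (b 0 : ℝ) * (1 - 1 / (8 * d)) = b 0 - (b 0 / (4 * d)) / 2 := by
    field_simp; ring
  have hq : 0 < (b 0 : ℝ) / (4 * d) := by positivity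
  have hlarge : ∀ i ≤ d, i ≠ m → (b 0 : ℝ) / (2 * d) ≤ b i + c i := fun i hi him ↦
    h.le_b_add_c_of_ne hd hi hmd him (by linarith)
  have hγ : ∀ x : ℝ, b 0 / (4 * d) ≤ x → ε * b 0 ≤ 4 * d * ε * x := by
    intro x hx
    calc ε * b 0 = 4 * d * ε * (b 0 / (4 * d)) := by field_simp
      _ ≤ 4 * d * ε * x := by gcongr
  set u := G.sphereAverage f v with hu
  obtain ⟨p, hp, hmax⟩ := exists_max_image (range (d + 1)) (fun i ↦ |u i|) ⟨0, by simp⟩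
  have hM : ∀ i, |u i| ≤ |u p| := by
    intro i
    rcases le_or_gt i d with hi | hi
    · exact hmax i (mem_range.2 (by omega))
    · rw [hu, SimpleGraph.sphereAverage, h.distSphere_eq_empty v hi]
      simp
  have hsmall := abs_le_of_tridiagonal (d := d) (m := m) (a := fun i ↦ a i) (b := fun i ↦ b i)
    (c := fun i ↦ c i) (u := u) (k := b 0) (γ := 4 * d * ε) (M := |u p|) (θ := θ)
    (fun i hi ↦ h.sphereAverage_recurrence hf v hi)
    (fun i hi ↦ by exact_mod_cast h.a_add_b_add_c hi)
    (fun i ↦ Nat.cast_nonneg _) (fun i ↦ Nat.cast_nonneg _) (fun i ↦ Nat.cast_nonneg _)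
    (by positivity) hM hmd (h.abs_sphereAverage_le hd hmd (by linarith) hbm hsum v hM)
    (fun i hi ↦ by
      have h1 := hlarge i (by omega) hi.ne
      have h2 := hc i hi.le
      have h3 := hγ (b i) (by linarith)
      exact ⟨by linarith, by linarith, by linarith⟩)
    (fun i hi hmi ↦ by
      have h1 := hlarge i hi hmi.ne'
      have h2 := hb i hi hmi
      have h3 := hγ (c i) (by linarith)
      exact ⟨by linarith, by linarith, by linarith⟩)
    p (by rw [mem_range] at hp; omega)
  have hu0 : u 0 = f v := by simp [hu, SimpleGraph.sphereAverage, h.distSphere_zero]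
  have hpos : 0 < |u p| := (abs_pos.2 (hu0 ▸ hv)).trans_le (hM 0)
  have := mul_lt_mul_of_pos_right hε hpos
  linarith

/-- An eigenvector whose eigenvalue is not the degree is orthogonal to the constants. -/
theorem eigenvalue_eq_of_sum_ne_zero (h : IsDistanceRegular G d a b c) {f : V → ℝ} {θ : ℝ}
    (hf : ∀ x, ∑ y ∈ G.neighborFinset x, f y = θ * f x) (hsum : ∑ x, f x ≠ 0) : θ = b 0 := by
  refine mul_right_cancel₀ hsum ?_
  rw [mul_sum, mul_sum]
  simp_rw [← hf, SimpleGraph.neighborFinset_eq_filter, sum_filter]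
  rw [sum_comm]
  refine sum_congr rfl fun y _ ↦ ?_
  simp_rw [G.adj_comm _ y]
  rw [← sum_filter, ← SimpleGraph.neighborFinset_eq_filter, sum_const, nsmul_eq_mul,
    G.card_neighborFinset_eq_degree, h.isRegularOfDegree y]

theorem zeroWeightSpectralRadius_le [DecidableEq V] (h : IsDistanceRegular G d a b c)
    (hd : 0 < d) {ε : ℝ} (hε0 : 0 < ε) (hε : 12 * d * 2 ^ d * ε < 1)
    (hbc : ∀ i < d, ε * b 0 ≤ b i → (c (i + 1) : ℝ) < ε * b 0) :
    zeroWeightSpectralRadius G ≤ b 0 * (1 - 1 / (8 * d)) := by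
  have hk : (0 : ℝ) < b 0 := by exact_mod_cast h.b_pos hd
  have hd' : (1 : ℝ) ≤ d := by exact_mod_cast hd
  have hgap : (b 0 : ℝ) * (1 - 1 / (8 * d)) < b 0 := by
    have : 0 < (b 0 : ℝ) * (1 / (8 * d)) := by positivity
    linarith
  have hnonneg : 0 ≤ (b 0 : ℝ) * (1 - 1 / (8 * d)) := by
    refine mul_nonneg hk.le (sub_nonneg.2 ?_)
    rw [div_le_one (by positivity)]
    linarith
  set hA := G.isHermitian_adjMatrix ℝ
  set e : Fin (Fintype.card V) ≃ V := Fintype.equivOfCardEq (Fintype.card_fin _)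
  have hval : ∀ i, hA.eigenvalues (e i) = hA.eigenvalues₀ i := fun i ↦
    congrArg hA.eigenvalues₀ (e.symm_apply_apply i)
  have hvec : ∀ j x, ∑ y ∈ G.neighborFinset x, hA.eigenvectorBasis j y =
      hA.eigenvalues j * hA.eigenvectorBasis j x := by
    intro j x
    have := congrFun (hA.mulVec_eigenvectorBasis j) x
    rwa [SimpleGraph.adjMatrix_mulVec_apply] at this
  have hne : ∀ j, ⇑(hA.eigenvectorBasis j) ≠ 0 := by
    intro j hj
    refine hA.eigenvectorBasis.orthonormal.ne_zero j ?_
    ext x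
    exact congrFun hj x
  refine Real.iSup_le (fun ⟨i, hi⟩ ↦ ?_) hnonneg
  change |hA.eigenvalues₀ i| ≤ _
  by_cases hsi : ∑ x, hA.eigenvectorBasis (e i) x = 0
  · rw [← hval]
    exact h.abs_eigenvalue_le hd hε0 hε hbc (hvec _) hsi (hne _)
  -- Otherwise `k` would be an eigenvalue of multiplicity at least two, and some eigenvector for
  -- it would be orthogonal to the constants.
  exfalso
  have hθi := h.eigenvalue_eq_of_sum_ne_zero (hvec _) hsi
  set z : Fin (Fintype.card V) := ⟨0, i.pos⟩
  have hzi : hA.eigenvalues₀ i ≤ hA.eigenvalues₀ z := hA.eigenvalues₀_antitone (Nat.zero_le _)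
  rw [← hval, ← hval, hθi] at hzi
  by_cases hsz : ∑ x, hA.eigenvectorBasis (e z) x = 0
  · have h1 := h.abs_eigenvalue_le hd hε0 hε hbc (hvec _) hsz (hne _)
    have h2 := le_abs_self (hA.eigenvalues (e z))
    linarith
  have hθz := h.eigenvalue_eq_of_sum_ne_zero (hvec _) hsz
  set s := ∑ x, hA.eigenvectorBasis (e i) x
  set t := ∑ x, hA.eigenvectorBasis (e z) x
  have hez : e z ≠ e i := fun hzi ↦ hi.ne (congrArg Fin.val (e.injective hzi))
  set g : EuclideanSpace ℝ V := s • hA.eigenvectorBasis (e z) - t • hA.eigenvectorBasis (e i)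
    with hg
  have hgx : ∀ x, g x = s * hA.eigenvectorBasis (e z) x - t * hA.eigenvectorBasis (e i) x :=
    fun x ↦ rfl
  have hg0 : ⇑g ≠ 0 := by
    intro hzero
    have hg' : g = 0 := by
      ext x
      exact congrFun hzero x
    have h1 : inner ℝ (hA.eigenvectorBasis (e z)) g = s := by
      have := orthonormal_iff_ite.1 hA.eigenvectorBasis.orthonormal
      rw [hg, inner_sub_right, real_inner_smul_right, real_inner_smul_right, this, this,
        if_pos rfl, if_neg hez]
      ring
    rw [hg', inner_zero_right] at h1
    exact hsi h1.symm
  have hgeig : ∀ x, ∑ y ∈ G.neighborFinset x, g y = (b 0 : ℝ) * g x := by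
    intro x
    simp_rw [hgx]
    rw [sum_sub_distrib, ← mul_sum, ← mul_sum, hvec, hvec, hθi, hθz]
    ring
  have hgsum : ∑ x, g x = 0 := by
    simp_rw [hgx]
    rw [sum_sub_distrib, ← mul_sum, ← mul_sum]
    change s * t - t * s = 0
    ring
  have h1 := h.abs_eigenvalue_le hd hε0 hε hbc hgeig hgsum hg0
  rw [Nat.abs_cast] at h1
  linarith

end IsDistanceRegular

theorem mainTheorem5 :
    ∀ d : ℕ, 2 ≤ d → ∃ ε η : ℝ,
      ε = (200 : ℝ) ^ (-((d : ℝ) + 1)) *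
        (d : ℝ) ^ (-(((d : ℝ) + 1) * (Real.logb 2 d + 3))) ∧
      η = 1 / 4 * (d : ℝ) ^ (-(1 + Real.logb 2 d)) ∧
      0 < ε ∧ 0 < η ∧
      ∀ (V : Type*) [Fintype V] [DecidableEq V] (G : SimpleGraph V) [DecidableRel G.Adj]
        (a b c : ℕ → ℕ) (k : ℕ),
        IsDistanceRegular G d a b c → G.IsRegularOfDegree k →
        (∃ i : ℕ, i ≤ d - 1 ∧ ε * k ≤ b i ∧ ε * k ≤ c (i + 1)) ∨
          zeroWeightSpectralRadius G ≤ k * (1 - η) := by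
  intro d hd
  have hd2 : (2 : ℝ) ≤ d := by exact_mod_cast hd
  have hd0 : (0 : ℝ) < d := by linarith
  have hlog : 1 ≤ Real.logb 2 d := by
    rw [Real.le_logb_iff_rpow_le one_lt_two hd0, Real.rpow_one]
    exact hd2
  refine ⟨_, _, rfl, rfl, by positivity, by positivity, ?_⟩
  set ε := (200 : ℝ) ^ (-((d : ℝ) + 1)) *
    (d : ℝ) ^ (-(((d : ℝ) + 1) * (Real.logb 2 d + 3))) with hεdef
  set η := 1 / 4 * (d : ℝ) ^ (-(1 + Real.logb 2 d)) with hηdef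
  have hε0 : 0 < ε := by positivity
  have hε : 12 * d * 2 ^ d * ε < 1 := by
    have h1 : ε ≤ (200 ^ (d + 1))⁻¹ := by
      have h2 : (d : ℝ) ^ (-(((d : ℝ) + 1) * (Real.logb 2 d + 3))) ≤ 1 :=
        Real.rpow_le_one_of_one_le_of_nonpos (by linarith)
          (neg_nonpos.2 (by positivity))
      have h3 : (200 : ℝ) ^ (-((d : ℝ) + 1)) = (200 ^ (d + 1))⁻¹ := by
        rw [Real.rpow_neg (by norm_num)]
        congr 1
        exact_mod_cast Real.rpow_natCast (200 : ℝ) (d + 1)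
      rw [hεdef, h3]
      exact mul_le_of_le_one_right (by positivity) h2
    have h4 : (d : ℝ) ≤ 2 ^ d := by exact_mod_cast Nat.lt_two_pow_self.le
    have h5 : (12 : ℝ) * d * 2 ^ d < 200 ^ (d + 1) := by
      calc (12 : ℝ) * d * 2 ^ d ≤ 12 * 2 ^ d * 2 ^ d := by gcongr
        _ = 12 * 4 ^ d := by rw [mul_assoc, ← mul_pow]; norm_num
        _ ≤ 12 * 200 ^ d := by gcongr; norm_num
        _ < 200 ^ (d + 1) := by
          rw [pow_succ']
          exact mul_lt_mul_of_pos_right (by norm_num) (by positivity)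
    calc 12 * d * 2 ^ d * ε ≤ 12 * d * 2 ^ d * (200 ^ (d + 1))⁻¹ := by gcongr
      _ < 1 := by
        rw [← div_eq_mul_inv, div_lt_one (by positivity)]
        exact h5
  have hη : η ≤ 1 / (8 * d) := by
    have h1 : (d : ℝ) ^ (-(1 + Real.logb 2 d)) ≤ (d : ℝ) ^ (-2 : ℝ) :=
      Real.rpow_le_rpow_of_exponent_le (by linarith) (by linarith)
    rw [Real.rpow_neg hd0.le 2, Real.rpow_two] at h1
    have h2 : ((d : ℝ) ^ 2)⁻¹ ≤ (2 * (d : ℝ))⁻¹ := by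
      gcongr
      nlinarith
    calc η ≤ 1 / 4 * (2 * (d : ℝ))⁻¹ := by rw [hηdef]; linarith
      _ = 1 / (8 * d) := by field_simp; norm_num
  intro V _ _ G _ a b c k h hreg
  obtain ⟨v⟩ := h.connected.nonempty
  obtain rfl : k = b 0 := (hreg v).symm.trans (h.isRegularOfDegree v)
  by_cases hbc : ∃ i : ℕ, i ≤ d - 1 ∧ ε * b 0 ≤ b i ∧ ε * b 0 ≤ c (i + 1)
  · exact Or.inl hbc
  · right
    push Not at hbc
    refine (h.zeroWeightSpectralRadius_le (by omega) hε0 hε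
      fun i hi ↦ hbc i (by omega)).trans ?_
    gcongr
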